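/- **Theorem (Sup-norm interpolation inequality).** Let $d\ge 1$ and $\alpha$ be integers with $\alpha>d/2$, and let $r>0$. There exist constants $c_1>0$ and $K_1>0$, depending only on $d$, $\alpha$ and $r$, such that the following holds. Let $x_0\in\mathbb R^d$ and let $\Omega\subset\mathbb R^d$ be an open set that is star-shaped with respect to every point of the ball $B(x_0,r)$ (for example a convex open set containing $B(x_0,r)$, such as an open cube centred at $x_0$ with edge length at least $2r$). Write $(1-\varepsilon^2)\Omega:=\{x_0+(1-\varepsilon^2)(y-x_0): y\in\Omega\}$ for the dilate of $\Omega$ about $x_0$ (for $x_0=0$ this is the usual multiple of $\Omega$). Then every $u\in W^{\alpha,2}(\Omega)$ is equal almost everywhere on $\Omega$ to a continuous function on $\Omega$, and for this continuous representative, again denoted $u$, and every $\varepsilon\in(0,c_1)$, $$\sup_{t\in(1-\varepsilon^2)\Omega}|u(t)|\;\le\; K_1\Big(\varepsilon^{-d}\,\|u\|_{2,\Omega}+\varepsilon^{2\alpha-d}\,|u|_{\alpha,2,\Omega}\Big).$$ Here $W^{\alpha,2}(\Omega)$ is the space of real functions $u\in L^2(\Omega)$ whose weak derivatives $D^{\mathbf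 k}u$ of total order $|\mathbf k|\le\alpha$ exist and lie in $L^2(\Omega)$, $\|u\|_{2,\Omega}=\big(\int_\Omega|u|^2\,dt\big)^{1/2}$, and $|u|_{\alpha,2,\Omega}=\big(\sum_{|\mathbf k|=\alpha}\int_\Omega|D^{\mathbf k}u(t)|^2\,dt\big)^{1/2}$. -/

import Mathlib

open Set MeasureTheory
open scoped ContDiff

noncomputable section

namespace SupInterp

/-- `d`-dimensional Euclidean space. -/
abbrev Euc (d : ℕ) : Type := EuclideanSpace ℝ (Fin d)

/-- The classical partial derivative of `φ` in the `i`-th coordinate direction. -/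
def classicalPartial {d : ℕ} (i : Fin d) (φ : Euc d → ℝ) : Euc d → ℝ :=
  fun x => fderiv ℝ φ x (EuclideanSpace.single i 1)

/-- The classical mixed derivative `D^k φ = ∂₁^{k₁} ⋯ ∂_d^{k_d} φ` for a multi-index `k`. It is only
used for smooth `φ`, where the order of differentiation is immaterial. -/
def classicalD {d : ℕ} (k : Fin d → ℕ) (φ : Euc d → ℝ) : Euc d → ℝ :=
  (List.finRange d).foldr (fun i ψ => (classicalPartial i)^[k i] ψ) φ

/-- `φ` is a test function on `Ω`: smooth, with compact support contained in `Ω`. -/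
structure IsTestFunction {d : ℕ} (Ω : Set (Euc d)) (φ : Euc d → ℝ) : Prop where
  smooth : ContDiff ℝ ∞ φ
  compact : HasCompactSupport φ
  support : tsupport φ ⊆ Ω

/-- `v` is a weak derivative `D^k u` on the open set `Ω`: `v` is locally integrable on `Ω` and
`∫_Ω u D^k φ = (-1)^{|k|} ∫_Ω v φ` for every test function `φ` on `Ω`. -/
structure HasWeakD {d : ℕ} (Ω : Set (Euc d)) (k : Fin d → ℕ) (u v : Euc d → ℝ) : Prop where
  locInt : LocallyIntegrableOn v Ω volume
  integral_eq : ∀ φ : Euc d → ℝ, IsTestFunction Ω φ →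
    ∫ x in Ω, u x * classicalD k φ x = (-1) ^ (∑ i, k i) * ∫ x in Ω, v x * φ x

/-- Weak derivatives are unique up to null sets, so the choice made in `weakD` is immaterial. -/
theorem HasWeakD.ae_eq {d : ℕ} {Ω : Set (Euc d)} (hΩ : IsOpen Ω) {k : Fin d → ℕ}
    {u v w : Euc d → ℝ} (hv : HasWeakD Ω k u v) (hw : HasWeakD Ω k u w) :
    v =ᵐ[volume.restrict Ω] w := by
  have key : ∀ᵐ x ∂(volume : Measure (Euc d)), x ∈ Ω → (v - w) x = 0 := by
    refine hΩ.ae_eq_zero_of_integral_contDiff_smul_eq_zero (hv.locInt.sub hw.locInt) ?_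
    intro g hg hc hs
    have e1 := hv.integral_eq g ⟨hg, hc, hs⟩
    have e2 := hw.integral_eq g ⟨hg, hc, hs⟩
    have e3 : ∫ x in Ω, v x * g x = ∫ x in Ω, w x * g x :=
      mul_left_cancel₀ (pow_ne_zero _ (by norm_num)) (e1.symm.trans e2)
    have hint : ∀ f : Euc d → ℝ, LocallyIntegrableOn f Ω volume →
        Integrable (fun x => f x * g x) (volume.restrict Ω) := by
      intro f hf
      have h1 : IntegrableOn (fun x => f x * g x) (tsupport g) volume :=
        (hf.integrableOn_compact_subset hs hc).mul_continuousOn hg.continuous.continuousOn hc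
      have h2 : Integrable (fun x => f x * g x) volume := by
        rw [← integrableOn_iff_integrable_of_support_subset (s := tsupport g)]
        · exact h1
        · intro x hx
          exact subset_tsupport g (right_ne_zero_of_mul hx)
      exact h2.integrableOn
    have e4 : ∫ x, g x • (v - w) x = ∫ x in Ω, g x • (v - w) x := by
      rw [setIntegral_eq_integral_of_forall_compl_eq_zero]
      intro x hx
      have : g x = 0 := by
        by_contra h
        exact hx (hs (subset_tsupport g h))
      simp [this]
    rw [e4]
    have e5 : ∀ x, g x • (v - w) x = v x * g x - w x * g x := by
      intro x; simp only [smul_eq_mul, Pi.sub_apply]; ring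
    simp only [e5]
    rw [integral_sub (hint v hv.locInt) (hint w hw.locInt), e3, sub_self]
  rw [Filter.EventuallyEq, ae_restrict_iff' hΩ.measurableSet]
  filter_upwards [key] with x hx hxΩ
  exact sub_eq_zero.mp (hx hxΩ)

open Classical in
/-- The weak derivative `D^k u` on `Ω` (and `0` if there is none). -/
def weakD {d : ℕ} (Ω : Set (Euc d)) (k : Fin d → ℕ) (u : Euc d → ℝ) : Euc d → ℝ :=
  if h : ∃ v, HasWeakD Ω k u v then h.choose else 0

/-- The Sobolev space `W^{α,2}(Ω)`: `u ∈ L²(Ω)`, and all weak derivatives of `u` of total order at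
most `α` exist and lie in `L²(Ω)`. -/
structure MemSobolev {d : ℕ} (α : ℕ) (Ω : Set (Euc d)) (u : Euc d → ℝ) : Prop where
  memLp : MemLp u 2 (volume.restrict Ω)
  weak : ∀ k : Fin d → ℕ, ∑ i, k i ≤ α →
    (∃ v, HasWeakD Ω k u v) ∧ MemLp (weakD Ω k u) 2 (volume.restrict Ω)

/-- The norm `‖u‖_{2,Ω} = (∫_Ω |u|²)^{1/2}`. -/
def l2Norm {d : ℕ} (Ω : Set (Euc d)) (u : Euc d → ℝ) : ℝ :=
  Real.sqrt (∫ x in Ω, |u x| ^ 2)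

/-- The seminorm `|u|_{α,2,Ω} = (∑_{|k| = α} ∫_Ω |D^k u|²)^{1/2}`; the sum runs over all
multi-indices `k` of total order `α`. -/
def sobolevSeminorm {d : ℕ} (α : ℕ) (Ω : Set (Euc d)) (u : Euc d → ℝ) : ℝ :=
  Real.sqrt (∑ k ∈ Finset.piAntidiag (Finset.univ : Finset (Fin d)) α,
    ∫ x in Ω, |weakD Ω k u x| ^ 2)

/-- The dilate of `Ω` about the point `x₀` by the factor `s`, that is `x₀ + s (Ω - x₀)`; for
`x₀ = 0` it is `s Ω`. -/
def dilate {d : ℕ} (x₀ : Euc d) (s : ℝ) (Ω : Set (Euc d)) : Set (Euc d) :=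
  (fun y => x₀ + s • (y - x₀)) '' Ω

end SupInterp

end

namespace SupInterp

/-! Write α = n + 1. If a kernel h on [0, 1] satisfies h^(j)(0) = 0 for j < n, h^(n)(0) = 1 and
h^(j)(1) = 0 for j ≤ n, repeated integration by parts gives f(0) = (-1)^(n+1) ∫ h f^(n+1) - ∫
h^(n+1) f. Take f(s) = u(t + sρy) and average over y against a weight φ of mass one on the unit
ball. This writes u(t) through averages at scales sρ of u and of its derivatives of order α, the
latter with a factor ρ^α.

By Cauchy–Schwarz and scaling, an average at scale sρ is at most a constant times (sρ)^(-d/2) times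
the L² norm. The kernel is chosen so that both h and h^(n+1) are O(s^n); since n - d/2 > -1, the
integral over s converges. The result is |u(t)| ≤ K ρ^(-d/2) (‖u‖ + ρ^α |u|_α), and the same
domination makes the representation continuous in t (`continuous_sobolevRep`,
`exists_abs_sobolevRep_le`).

For weak derivatives the formula is tested against a smooth χ: s ↦ ∫ u(z) χ(z - sρy) dz is smooth
whatever u is, its derivatives fall on χ, and the top one is rewritten by the definition of a weak
derivative (`IsWeakJet.integral_mul_eq`). Fubini then identifies the representation with u almost
everywhere where there is room, and representations for different ρ glue.

Star-shapedness about B(x₀, r) gives B(t, ε²r) ⊆ Ω for t in the dilate, so ρ = ε²r/2 is admissible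
and produces the powers ε^(-d) and ε^(2α-d). -/

/-! ### The one-dimensional Taylor formula and its kernel. -/

theorem integral_mul_iterated_deriv {n : ℕ} (h f : ℕ → ℝ → ℝ)
    (hh : ∀ j s, HasDerivAt (h j) (h (j + 1) s) s)
    (hf : ∀ j s, HasDerivAt (f j) (f (j + 1) s) s)
    (h0 : ∀ j < n, h j 0 = 0) (h1 : ∀ j < n, h j 1 = 0) :
    ∫ s in (0 : ℝ)..1, h 0 s * f n s = (-1) ^ n * ∫ s in (0 : ℝ)..1, h n s * f 0 s := by
  induction n generalizing h with
  | zero => simp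
  | succ n ih =>
    have cont : ∀ (g : ℕ → ℝ → ℝ), (∀ j s, HasDerivAt (g j) (g (j + 1) s) s) → ∀ j,
        Continuous (g j) := fun g hg j =>
      continuous_iff_continuousAt.2 fun s => (hg j s).continuousAt
    have key := intervalIntegral.integral_mul_deriv_eq_deriv_mul (a := 0) (b := 1)
      (u := h 0) (v := f n) (u' := h 1) (v' := f (n + 1))
      (fun x _ => hh 0 x) (fun x _ => hf n x)
      ((cont h hh 1).intervalIntegrable _ _) ((cont f hf _).intervalIntegrable _ _)
    rw [key, h0 0 (by omega), h1 0 (by omega),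
      ih (fun j => h (j + 1)) (fun j s => hh (j + 1) s) (fun j hj => h0 _ (by omega))
        (fun j hj => h1 _ (by omega))]
    ring

/-- After n integrations by parts without boundary terms, the next one meets `h n 0 = 1` and
releases the value of f at 0. -/
theorem eval_zero_eq_integral_iterated_deriv {n : ℕ} (h f : ℕ → ℝ → ℝ)
    (hh : ∀ j s, HasDerivAt (h j) (h (j + 1) s) s)
    (hf : ∀ j s, HasDerivAt (f j) (f (j + 1) s) s)
    (h0 : ∀ j < n, h j 0 = 0) (hn : h n 0 = 1) (h1 : ∀ j ≤ n, h j 1 = 0) :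
    f 0 0 = (-1) ^ (n + 1) * (∫ s in (0 : ℝ)..1, h 0 s * f (n + 1) s) -
      ∫ s in (0 : ℝ)..1, h (n + 1) s * f 0 s := by
  have cont : ∀ (g : ℕ → ℝ → ℝ), (∀ j s, HasDerivAt (g j) (g (j + 1) s) s) → ∀ j,
      Continuous (g j) := fun g hg j =>
    continuous_iff_continuousAt.2 fun s => (hg j s).continuousAt
  have key := intervalIntegral.integral_mul_deriv_eq_deriv_mul (a := 0) (b := 1)
    (u := h n) (v := f 0) (u' := h (n + 1)) (v' := f 1)
    (fun x _ => hh n x) (fun x _ => hf 0 x)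
    ((cont h hh _).intervalIntegrable _ _) ((cont f hf _).intervalIntegrable _ _)
  have e := integral_mul_iterated_deriv (n := n) h (fun j => f (j + 1)) hh
    (fun j s => hf (j + 1) s) h0 (fun j hj => h1 j hj.le)
  simp only [zero_add] at e
  rw [e, key, hn, h1 n le_rfl, pow_succ]
  have : ((-1 : ℝ) ^ n) * (-1) ^ n = 1 := by rw [← mul_pow]; norm_num
  linear_combination (-(∫ s in (0 : ℝ)..1, h (n + 1) s * f 0 s) - f 0 0) * this

theorem exists_bound_of_X_pow_dvd {n : ℕ} {p : Polynomial ℝ} (hp : Polynomial.X ^ n ∣ p) :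
    ∃ C, 0 ≤ C ∧ ∀ s ∈ Icc (0 : ℝ) 1, |p.eval s| ≤ C * s ^ n := by
  obtain ⟨q, rfl⟩ := hp
  obtain ⟨C, hC⟩ := isCompact_Icc.exists_bound_of_continuousOn (s := Icc (0 : ℝ) 1)
    q.continuous.continuousOn
  refine ⟨C, (norm_nonneg _).trans (hC 0 (by simp)), fun s hs => ?_⟩
  have := hC s hs
  rw [Real.norm_eq_abs] at this
  rw [Polynomial.eval_mul, Polynomial.eval_pow, Polynomial.eval_X, abs_mul,
    abs_of_nonneg (pow_nonneg hs.1 n), mul_comm]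
  exact mul_le_mul_of_nonneg_right this (pow_nonneg hs.1 n)

/-- A smooth kernel on `[0, 1]` which, together with its derivative of order `n + 1`, vanishes to
order `n` at `0`. -/
structure IsTaylorKernel (n : ℕ) (h : ℕ → ℝ → ℝ) : Prop where
  hasDerivAt : ∀ j s, HasDerivAt (h j) (h (j + 1) s) s
  zero_of_lt : ∀ j < n, h j 0 = 0
  one : h n 0 = 1
  end_zero : ∀ j ≤ n, h j 1 = 0
  bound : ∃ C, 0 ≤ C ∧ ∀ s ∈ Icc (0 : ℝ) 1, |h 0 s| ≤ C * s ^ n ∧ |h (n + 1) s| ≤ C * s ^ n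

theorem IsTaylorKernel.continuous {n : ℕ} {h : ℕ → ℝ → ℝ} (hh : IsTaylorKernel n h) (j : ℕ) :
    Continuous (h j) :=
  continuous_iff_continuousAt.2 fun s => (hh.hasDerivAt j s).continuousAt

-- The kernel is the polynomial X^n (1 - X^(n+1))^(n+1) / n!. The second factor gives a zero of
-- order n + 1 at 1. Expanded at 0 it is X^n / n! plus a multiple of X^(2n+1): n + 1 derivatives
-- kill the first term and leave the second divisible by X^n.
open Polynomial in
theorem exists_isTaylorKernel (n : ℕ) : ∃ h, IsTaylorKernel n h := by
  set c : ℝ := (n.factorial : ℝ)⁻¹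
  have hc : c * n.factorial = 1 := inv_mul_cancel₀ (by positivity)
  obtain ⟨q, hq⟩ : (X : ℝ[X]) ^ (n + 1) ∣ (1 - X ^ (n + 1)) ^ (n + 1) - 1 := by
    have := sub_dvd_pow_sub_pow (1 - (X : ℝ[X]) ^ (n + 1)) 1 (n + 1)
    rw [one_pow] at this
    refine dvd_trans ?_ this
    exact ⟨-1, by ring⟩
  set P : ℝ[X] := C c * X ^ n * (1 - X ^ (n + 1)) ^ (n + 1) with hP
  have hP' : P = C c * X ^ n + X ^ (2 * n + 1) * (C c * q) := by
    have : (1 - (X : ℝ[X]) ^ (n + 1)) ^ (n + 1) = 1 + X ^ (n + 1) * q := by rw [← hq]; ring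
    rw [hP, this]; ring
  have hX : X ^ n ∣ P := ⟨C c * (1 - X ^ (n + 1)) ^ (n + 1), by rw [hP]; ring⟩
  have hX1 : (X - C 1) ^ (n + 1) ∣ P := by
    refine Dvd.dvd.mul_left (pow_dvd_pow_of_dvd ?_ _) _
    have := sub_dvd_pow_sub_pow (1 : ℝ[X]) X (n + 1)
    rw [one_pow] at this
    refine dvd_trans ⟨-1, ?_⟩ this
    rw [C_1]; ring
  have hder : X ^ n ∣ derivative^[n + 1] P := by
    rw [hP', iterate_map_add]
    have e : derivative^[n + 1] (C c * X ^ n : ℝ[X]) = 0 :=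
      iterate_derivative_eq_zero ((natDegree_C_mul_X_pow_le c n).trans_lt (Nat.lt_succ_self n))
    rw [e, zero_add]
    have := pow_sub_dvd_iterate_derivative_of_pow_dvd (n + 1)
      (p := X ^ (2 * n + 1) * (C c * q)) (q := X) (n := 2 * n + 1) (Dvd.intro _ rfl)
    rwa [show 2 * n + 1 - (n + 1) = n by omega] at this
  obtain ⟨C₁, hC₁, b₁⟩ := exists_bound_of_X_pow_dvd hX
  obtain ⟨C₂, hC₂, b₂⟩ := exists_bound_of_X_pow_dvd hder
  refine ⟨fun j s => (derivative^[j] P).eval s, ⟨?_, ?_, ?_, ?_, C₁ + C₂, by positivity, ?_⟩⟩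
  · intro j s
    rw [Function.iterate_succ_apply']
    exact Polynomial.hasDerivAt _ _
  · intro j hj
    have := pow_sub_dvd_iterate_derivative_of_pow_dvd j hX
    show (derivative^[j] P).eval 0 = 0
    rw [← coeff_zero_eq_eval_zero]
    exact X_dvd_iff.1 ((dvd_pow_self X (by omega)).trans this)
  · show (derivative^[n] P).eval 0 = 1
    rw [← coeff_zero_eq_eval_zero, coeff_iterate_derivative, hP', zero_add,
      Nat.descFactorial_self, coeff_add, coeff_C_mul_X_pow, coeff_X_pow_mul']
    rw [if_pos rfl, if_neg (by omega), add_zero, nsmul_eq_mul, mul_comm, hc]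
  · intro j hj
    have := pow_sub_dvd_iterate_derivative_of_pow_dvd j hX1
    exact dvd_iff_isRoot.1 ((dvd_pow_self _ (by omega)).trans this)
  · intro s hs
    have := pow_nonneg hs.1 n
    refine ⟨(b₁ s hs).trans ?_, (b₂ s hs).trans ?_⟩ <;> nlinarith

/-! ### Directional derivatives and multi-indices. -/

variable {d : ℕ}

/-- The derivative of `g` in the direction `e`. -/
noncomputable def dirD (e : Euc d) (g : Euc d → ℝ) : Euc d → ℝ := fun x => fderiv ℝ g x e

theorem contDiff_dirD (e : Euc d) {g : Euc d → ℝ} (hg : ContDiff ℝ ∞ g) :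
    ContDiff ℝ ∞ (dirD e g) :=
  (hg.fderiv_right (m := ∞) (by simp)).clm_apply contDiff_const

theorem tsupport_dirD_subset (e : Euc d) (g : Euc d → ℝ) : tsupport (dirD e g) ⊆ tsupport g :=
  tsupport_fderiv_apply_subset ℝ e

theorem dirD_comm (e e' : Euc d) {g : Euc d → ℝ} (hg : ContDiff ℝ ∞ g) :
    dirD e (dirD e' g) = dirD e' (dirD e g) := by
  have hd : Differentiable ℝ (fderiv ℝ g) :=
    (hg.fderiv_right (m := ∞) (by simp)).differentiable (by simp)
  have key : ∀ (a b x : Euc d), dirD a (dirD b g) x = fderiv ℝ (fderiv ℝ g) x a b := by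
    intro a b x
    have : HasFDerivAt (dirD b g) ((fderiv ℝ (fderiv ℝ g) x).flip b) x := by
      have := ((hd x).hasFDerivAt).clm_apply (hasFDerivAt_const b x)
      rw [ContinuousLinearMap.comp_zero, zero_add] at this
      exact this
    show fderiv ℝ (dirD b g) x a = _
    rw [this.fderiv]; rfl
  funext x
  rw [key, key]
  exact (hg.contDiffAt.isSymmSndFDerivAt (by simpa using WithTop.coe_le_coe.2 (le_top : (2 : ℕ∞) ≤ ⊤))) e e'

theorem dirD_comp_sub (e a : Euc d) (g : Euc d → ℝ) :
    dirD e (fun x => g (x - a)) = fun x => dirD e g (x - a) := by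
  funext x
  simp only [dirD, fderiv_comp_sub]

theorem dirD_eq_sum (e : Euc d) (g : Euc d → ℝ) (x : Euc d) :
    dirD e g x = ∑ i, e i * classicalPartial i g x := by
  have he : e = ∑ i, e i • EuclideanSpace.single i (1 : ℝ) := by
    ext j
    simp [Finset.sum_apply, Pi.single_apply]
  conv_lhs => rw [dirD, he, map_sum]
  simp [classicalPartial]

theorem contDiff_iterate_dirD (e : Euc d) {g : Euc d → ℝ} (hg : ContDiff ℝ ∞ g) (m : ℕ) :
    ContDiff ℝ ∞ ((dirD e)^[m] g) := by
  induction m with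
  | zero => exact hg
  | succ m ih => rw [Function.iterate_succ_apply']; exact contDiff_dirD e ih

theorem tsupport_iterate_dirD_subset (e : Euc d) (g : Euc d → ℝ) (m : ℕ) :
    tsupport ((dirD e)^[m] g) ⊆ tsupport g := by
  induction m with
  | zero => exact subset_rfl
  | succ m ih =>
    rw [Function.iterate_succ_apply']; exact (tsupport_dirD_subset e _).trans ih

theorem dirD_iterate_comm (e e' : Euc d) {g : Euc d → ℝ} (hg : ContDiff ℝ ∞ g) (m : ℕ) :
    dirD e ((dirD e')^[m] g) = (dirD e')^[m] (dirD e g) := by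
  induction m with
  | zero => rfl
  | succ m ih =>
    rw [Function.iterate_succ_apply', Function.iterate_succ_apply',
      dirD_comm e e' (contDiff_iterate_dirD e' hg m), ih]

theorem iterate_dirD_comp_sub (e a : Euc d) (g : Euc d → ℝ) (m : ℕ) :
    (dirD e)^[m] (fun x => g (x - a)) = fun x => (dirD e)^[m] g (x - a) := by
  induction m with
  | zero => rfl
  | succ m ih => rw [Function.iterate_succ_apply', Function.iterate_succ_apply', ih, dirD_comp_sub]

/-- The iterated partial derivatives in the directions listed in `L`. -/
noncomputable def listD (L : List (Fin d)) (k : Fin d → ℕ) (g : Euc d → ℝ) : Euc d → ℝ :=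
  L.foldr (fun i ψ => (dirD (EuclideanSpace.single i 1))^[k i] ψ) g

theorem classicalD_eq_listD (k : Fin d → ℕ) (g : Euc d → ℝ) :
    classicalD k g = listD (List.finRange d) k g := rfl

theorem listD_cons (i : Fin d) (L : List (Fin d)) (k : Fin d → ℕ) (g : Euc d → ℝ) :
    listD (i :: L) k g = (dirD (EuclideanSpace.single i 1))^[k i] (listD L k g) := rfl

theorem contDiff_listD (L : List (Fin d)) (k : Fin d → ℕ) {g : Euc d → ℝ}
    (hg : ContDiff ℝ ∞ g) : ContDiff ℝ ∞ (listD L k g) := by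
  induction L with
  | nil => exact hg
  | cons i L ih => exact contDiff_iterate_dirD _ ih _

theorem tsupport_listD_subset (L : List (Fin d)) (k : Fin d → ℕ) (g : Euc d → ℝ) :
    tsupport (listD L k g) ⊆ tsupport g := by
  induction L with
  | nil => exact subset_rfl
  | cons i L ih => exact (tsupport_iterate_dirD_subset _ _ _).trans ih

theorem listD_comp_sub (L : List (Fin d)) (k : Fin d → ℕ) (g : Euc d → ℝ) (a : Euc d) :
    listD L k (fun x => g (x - a)) = fun x => listD L k g (x - a) := by
  induction L with
  | nil => rfl
  | cons i L ih => rw [listD_cons, ih, iterate_dirD_comp_sub]; rfl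

theorem listD_zero (L : List (Fin d)) (g : Euc d → ℝ) : listD L 0 g = g := by
  induction L with
  | nil => rfl
  | cons i L ih => rw [listD_cons, ih]; rfl

theorem listD_add_single_of_notMem {L : List (Fin d)} {i : Fin d} (hi : i ∉ L) (k : Fin d → ℕ)
    (g : Euc d → ℝ) : listD L (k + Pi.single i 1) g = listD L k g := by
  induction L with
  | nil => rfl
  | cons j L ih =>
    rw [List.mem_cons, not_or] at hi
    rw [listD_cons, listD_cons, ih hi.2]
    simp [Ne.symm hi.1]

/-- The new derivative commutes past the other directions to the block of its own. Without `Nodup`,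
raising `k i` would add a derivative at each occurrence of `i`. -/
theorem dirD_listD {L : List (Fin d)} (hL : L.Nodup) {i : Fin d} (hi : i ∈ L) (k : Fin d → ℕ)
    {g : Euc d → ℝ} (hg : ContDiff ℝ ∞ g) :
    dirD (EuclideanSpace.single i 1) (listD L k g) = listD L (k + Pi.single i 1) g := by
  induction L with
  | nil => simp at hi
  | cons j L ih =>
    rw [List.nodup_cons] at hL
    rw [listD_cons, listD_cons]
    by_cases hij : i = j
    · subst hij
      rw [listD_add_single_of_notMem hL.1, ← Function.iterate_succ_apply' (dirD _)]
      simp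
    · have hiL : i ∈ L := (List.mem_cons.1 hi).resolve_left hij
      rw [dirD_iterate_comm _ _ (contDiff_listD L k hg), ih hL.2 hiL]
      simp [Ne.symm hij]

theorem classicalPartial_classicalD (i : Fin d) (k : Fin d → ℕ) {g : Euc d → ℝ}
    (hg : ContDiff ℝ ∞ g) :
    classicalPartial i (classicalD k g) = classicalD (k + Pi.single i 1) g :=
  dirD_listD (List.nodup_finRange d) (List.mem_finRange i) k hg

/-- The multi-index counting the entries of a finite sequence of coordinate directions. -/
def multiIndex {n : ℕ} (I : Fin n → Fin d) : Fin d → ℕ := ∑ j, Pi.single (I j) 1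

theorem sum_multiIndex {n : ℕ} (I : Fin n → Fin d) : ∑ i, multiIndex I i = n := by
  simp only [multiIndex, Finset.sum_apply]
  rw [Finset.sum_comm]
  simp

/-- Summing over sequences of directions instead of multi-indices avoids multinomial coefficients.
-/
theorem iterate_dirD_eq_sum (e : Euc d) {g : Euc d → ℝ} (hg : ContDiff ℝ ∞ g) (n : ℕ)
    (x : Euc d) : (dirD e)^[n] g x =
      ∑ I : Fin n → Fin d, (∏ j, e (I j)) * classicalD (multiIndex I) g x := by
  induction n generalizing x with
  | zero =>
    simp [multiIndex, classicalD_eq_listD, listD_zero]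
  | succ n ih =>
    rw [Function.iterate_succ_apply', funext ih, dirD_eq_sum,
      ← (Fin.consEquiv (fun _ : Fin (n + 1) => Fin d)).sum_comp, Fintype.sum_prod_type]
    refine Finset.sum_congr rfl fun i _ => ?_
    have hd : ∀ I : Fin n → Fin d, DifferentiableAt ℝ (classicalD (multiIndex I) g) x :=
      fun I => (contDiff_listD _ _ hg).differentiable (by simp) x
    have : classicalPartial i
        (fun x => ∑ I : Fin n → Fin d, (∏ j, e (I j)) * classicalD (multiIndex I) g x) x =
        ∑ I : Fin n → Fin d, (∏ j, e (I j)) * classicalPartial i (classicalD (multiIndex I) g) x := by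
      unfold classicalPartial
      rw [fderiv_fun_sum fun I _ => (hd I).const_mul _, sum_apply]
      refine Finset.sum_congr rfl fun I _ => ?_
      rw [fderiv_const_mul (hd I)]; rfl
    rw [this, Finset.mul_sum]
    refine Finset.sum_congr rfl fun I _ => ?_
    rw [classicalPartial_classicalD i _ hg, Fin.prod_univ_succ]
    have : multiIndex (Fin.consEquiv (fun _ : Fin (n + 1) => Fin d) (i, I)) =
        multiIndex I + Pi.single i 1 := by
      simp [multiIndex, Fin.sum_univ_succ, Fin.consEquiv, add_comm]
    rw [this]
    simp [Fin.consEquiv, mul_assoc]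

theorem IsTestFunction.comp_sub {Ω : Set (Euc d)} {χ : Euc d → ℝ} (hχ : ContDiff ℝ ∞ χ)
    (hc : HasCompactSupport χ) {a : Euc d} (ha : ∀ x ∈ tsupport χ, x + a ∈ Ω) :
    IsTestFunction Ω (fun x => χ (x - a)) where
  smooth := hχ.comp (contDiff_id.sub contDiff_const)
  compact := hc.comp_homeomorph (Homeomorph.subRight a)
  support := by
    intro x hx
    have : x - a ∈ tsupport χ := by
      have := tsupport_comp_subset_preimage χ (f := fun x : Euc d => x - a)
        (continuous_id.sub continuous_const) hx
      exact this
    simpa using ha _ this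

/-! ### L² norms under translation and scaling. -/

theorem l2Norm_univ (f : Euc d → ℝ) : l2Norm univ f = Real.sqrt (∫ x, f x ^ 2) := by
  simp [l2Norm]

theorem l2Norm_nonneg (Ω : Set (Euc d)) (f : Euc d → ℝ) : 0 ≤ l2Norm Ω f := Real.sqrt_nonneg _

theorem integral_abs_mul_le {f g : Euc d → ℝ} (hf : MemLp f 2 volume) (hg : MemLp g 2 volume) :
    ∫ x, |f x * g x| ≤ l2Norm univ f * l2Norm univ g := by
  have h := integral_mul_norm_le_Lp_mul_Lq (μ := volume) (f := f) (g := g)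
    (p := 2) (q := 2) Real.HolderConjugate.two_two (by simpa using hf) (by simpa using hg)
  simp only [Real.norm_eq_abs, Real.rpow_two, sq_abs, ← Real.sqrt_eq_rpow] at h
  simpa only [l2Norm_univ, abs_mul] using h

theorem integrable_mul_of_memLp {f g : Euc d → ℝ} (hf : MemLp f 2 volume)
    (hg : MemLp g 2 volume) : Integrable (fun x => f x * g x) :=
  hf.integrable_mul hg

theorem memLp_comp_add {w : Euc d → ℝ} (hw : MemLp w 2 volume) (a : Euc d) :
    MemLp (fun x => w (x + a)) 2 volume :=
  hw.comp_measurePreserving (measurePreserving_add_right volume a)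

theorem l2Norm_comp_add (w : Euc d → ℝ) (a : Euc d) :
    l2Norm univ (fun x => w (x + a)) = l2Norm univ w := by
  rw [l2Norm_univ, l2Norm_univ, integral_add_right_eq_self (fun x => w x ^ 2) a]

theorem memLp_comp_add_smul {w : Euc d → ℝ} (hm : Measurable w) (hw : MemLp w 2 volume)
    (t : Euc d) {a : ℝ} (ha : 0 < a) : MemLp (fun y => w (t + a • y)) 2 volume := by
  have hmeas : Measurable fun y : Euc d => w (t + a • y) := hm.comp (by fun_prop)
  rw [memLp_two_iff_integrable_sq hmeas.aestronglyMeasurable]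
  have h := (memLp_two_iff_integrable_sq hw.1).1 hw
  exact (h.comp_add_left t).comp_smul (R := a) ha.ne'

theorem l2Norm_comp_add_smul (w : Euc d → ℝ) (t : Euc d) {a : ℝ} (ha : 0 < a) :
    l2Norm univ (fun y => w (t + a • y)) = a ^ (-(d : ℝ) / 2) * l2Norm univ w := by
  have h := Measure.integral_comp_smul (volume : Measure (Euc d)) (fun y => w (t + y) ^ 2) a
  rw [integral_add_left_eq_self (fun x => w x ^ 2) t] at h
  rw [l2Norm_univ, l2Norm_univ, h, smul_eq_mul, Real.sqrt_mul (abs_nonneg _)]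
  congr 1
  rw [finrank_euclideanSpace_fin, abs_of_pos (by positivity), Real.sqrt_eq_rpow,
    ← Real.rpow_natCast, ← Real.rpow_neg ha.le, ← Real.rpow_mul ha.le]
  congr 1; ring

/-! ### Averages at one scale and their superposition over scales. -/

/-- The average of `w` around `t`, at scale `a`, against the weight `ψ`. -/
noncomputable def scaledAverage (ψ w : Euc d → ℝ) (a : ℝ) (t : Euc d) : ℝ :=
  ∫ y, ψ y * w (t + a • y)

theorem abs_scaledAverage_le {ψ w : Euc d → ℝ} (hψ : MemLp ψ 2 volume) (hm : Measurable w)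
    (hw : MemLp w 2 volume) {a : ℝ} (ha : 0 < a) (t : Euc d) :
    |scaledAverage ψ w a t| ≤ l2Norm univ ψ * (a ^ (-(d : ℝ) / 2) * l2Norm univ w) := by
  rw [← l2Norm_comp_add_smul w t ha]
  exact (abs_integral_le_integral_abs).trans
    (integral_abs_mul_le hψ (memLp_comp_add_smul hm hw t ha))

/-- At a fixed positive scale the average is, up to a constant, the convolution of w with a
reflected rescaling of ψ, which is continuous with compact support. -/
theorem continuous_scaledAverage {ψ w : Euc d → ℝ} (hψ : Continuous ψ) (hc : HasCompactSupport ψ)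
    (hw : MemLp w 2 volume) {a : ℝ} (ha : 0 < a) : Continuous (scaledAverage ψ w a) := by
  set g : Euc d → ℝ := fun x => ψ ((-a⁻¹) • x) with hg
  have hgc : HasCompactSupport g :=
    hc.comp_homeomorph (Homeomorph.smulOfNeZero (-a⁻¹) (neg_ne_zero.2 (inv_ne_zero ha.ne')))
  have hcont := hgc.continuous_convolution_right (ContinuousLinearMap.mul ℝ ℝ) (μ := volume)
    (hw.locallyIntegrable one_le_two) (hψ.comp (continuous_const_smul _))
  have : scaledAverage ψ w a = fun t => |(a ^ Module.finrank ℝ (Euc d))⁻¹| *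
      (convolution w g (ContinuousLinearMap.mul ℝ ℝ) volume) t := by
    funext t
    rw [scaledAverage, convolution_def]
    have h := Measure.integral_comp_smul (volume : Measure (Euc d))
      (fun z => w (t + z) * g (t - (t + z))) a
    rw [integral_add_left_eq_self (fun z => w z * g (t - z)) t] at h
    simp only [ContinuousLinearMap.mul_apply']
    rw [← smul_eq_mul, ← h]
    congr 1
    funext y
    have : (-a⁻¹) • (t - (t + a • y)) = y := by
      rw [sub_add_cancel_left, smul_neg, neg_smul, neg_neg, smul_smul, inv_mul_cancel₀ ha.ne',
        one_smul]
    simp only [hg, this, mul_comm]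
  rw [this]
  exact continuous_const.mul hcont

/-- The superposition over the scales `s ρ`, `0 < s ≤ 1`, of averages of `w`. -/
noncomputable def radialPotential (κ : ℝ → ℝ) (ψ : Euc d → ℝ) (ρ : ℝ) (w : Euc d → ℝ)
    (t : Euc d) : ℝ :=
  ∫ s in Ioc (0 : ℝ) 1, κ s * scaledAverage ψ w (s * ρ) t

/-- This is where α > d/2 is decisive: it says precisely that the exponent exceeds -1. -/
theorem integrableOn_rpow_sub {n : ℕ} (hn : (d : ℝ) / 2 < (n + 1 : ℕ)) :
    IntegrableOn (fun s : ℝ => s ^ ((n : ℝ) - d / 2)) (Ioc 0 1) volume := by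
  rw [← intervalIntegrable_iff_integrableOn_Ioc_of_le zero_le_one]
  refine intervalIntegral.intervalIntegrable_rpow' ?_
  push_cast at hn
  linarith

/-- The integral of the radial weight. -/
noncomputable def radialMass (d n : ℕ) : ℝ := ∫ s in Ioc (0 : ℝ) 1, s ^ ((n : ℝ) - (d : ℝ) / 2)

theorem radialMass_nonneg (d n : ℕ) : 0 ≤ radialMass d n :=
  setIntegral_nonneg measurableSet_Ioc fun _ hs => Real.rpow_nonneg hs.1.le _

theorem measurable_uncurry_scaledAverage {ψ w : Euc d → ℝ} (hψ : Continuous ψ) (hm : Measurable w)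
    (ρ : ℝ) (t : Euc d) : StronglyMeasurable (fun s : ℝ => scaledAverage ψ w (s * ρ) t) := by
  have : StronglyMeasurable
      (fun p : ℝ × Euc d => ψ p.2 * w (t + (p.1 * ρ) • p.2)) := by
    refine Measurable.stronglyMeasurable ?_
    exact (hψ.measurable.comp measurable_snd).mul (hm.comp (by fun_prop))
  exact this.integral_prod_right'

theorem norm_mul_scaledAverage_le {κ : ℝ → ℝ} {n : ℕ} {C ρ : ℝ} {ψ w : Euc d → ℝ}
    (hκ : ∀ s ∈ Icc (0 : ℝ) 1, |κ s| ≤ C * s ^ n) (hρ : 0 < ρ)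
    (hψ : MemLp ψ 2 volume) (hm : Measurable w) (hw : MemLp w 2 volume) {s : ℝ}
    (hs : s ∈ Ioc (0 : ℝ) 1) (t : Euc d) :
    ‖κ s * scaledAverage ψ w (s * ρ) t‖ ≤
      C * l2Norm univ ψ * (ρ ^ (-(d : ℝ) / 2) * l2Norm univ w) * s ^ ((n : ℝ) - d / 2) := by
  have h1 := hκ s ⟨hs.1.le, hs.2⟩
  have h2 := abs_scaledAverage_le hψ hm hw (mul_pos hs.1 hρ) t
  rw [Real.norm_eq_abs, abs_mul]
  refine (mul_le_mul h1 h2 (abs_nonneg _) ((abs_nonneg _).trans h1)).trans_eq ?_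
  rw [Real.mul_rpow hs.1.le hρ.le, sub_eq_add_neg, Real.rpow_add hs.1, Real.rpow_natCast,
    ← neg_div]
  ring

theorem abs_radialPotential_le {κ : ℝ → ℝ} {n : ℕ} (hn : (d : ℝ) / 2 < (n + 1 : ℕ)) {C ρ : ℝ}
    {ψ w : Euc d → ℝ} (hκ : ∀ s ∈ Icc (0 : ℝ) 1, |κ s| ≤ C * s ^ n) (hρ : 0 < ρ)
    (hψ : MemLp ψ 2 volume) (hm : Measurable w) (hw : MemLp w 2 volume) (t : Euc d) :
    |radialPotential κ ψ ρ w t| ≤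
      C * l2Norm univ ψ * (ρ ^ (-(d : ℝ) / 2) * l2Norm univ w) * radialMass d n := by
  rw [radialMass, ← integral_const_mul]
  refine norm_integral_le_of_norm_le (f := fun s => κ s * scaledAverage ψ w (s * ρ) t)
    ((integrableOn_rpow_sub hn).const_mul _) ?_
  exact (ae_restrict_iff' measurableSet_Ioc).2 (Filter.Eventually.of_forall fun s hs =>
    norm_mul_scaledAverage_le hκ hρ hψ hm hw hs t)

theorem continuous_radialPotential {κ : ℝ → ℝ} (hκc : Continuous κ) {n : ℕ}
    (hn : (d : ℝ) / 2 < (n + 1 : ℕ)) {C ρ : ℝ} {ψ w : Euc d → ℝ}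
    (hκ : ∀ s ∈ Icc (0 : ℝ) 1, |κ s| ≤ C * s ^ n) (hρ : 0 < ρ) (hψ : Continuous ψ)
    (hc : HasCompactSupport ψ) (hm : Measurable w) (hw : MemLp w 2 volume) :
    Continuous (radialPotential κ ψ ρ w) := by
  refine continuous_of_dominated
    (bound := fun s => C * l2Norm univ ψ * (ρ ^ (-(d : ℝ) / 2) * l2Norm univ w) *
      s ^ ((n : ℝ) - d / 2)) (fun t => ?_) (fun t => ?_)
    ((integrableOn_rpow_sub hn).const_mul _) ?_
  · exact (hκc.stronglyMeasurable.mul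
      (measurable_uncurry_scaledAverage hψ hm ρ t)).aestronglyMeasurable
  · exact (ae_restrict_iff' measurableSet_Ioc).2 (Filter.Eventually.of_forall fun s hs =>
      norm_mul_scaledAverage_le hκ hρ (hψ.memLp_of_hasCompactSupport hc) hm hw hs t)
  · exact (ae_restrict_iff' measurableSet_Ioc).2 (Filter.Eventually.of_forall fun s hs =>
      continuous_const.mul (continuous_scaledAverage hψ hc hw (mul_pos hs.1 hρ)))

/-- Integrating in t first, Cauchy–Schwarz and translation invariance bound the pairing of w with χ
uniformly in y and s, so no singularity at s = 0 appears. This licenses the uses of Fubini. -/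
theorem integrable_kernel_mul {κ : ℝ → ℝ} (hκ : Continuous κ) {ψ w χ : Euc d → ℝ} (ρ : ℝ)
    (hψ : Continuous ψ) (hc : HasCompactSupport ψ) (hm : Measurable w) (hw : MemLp w 2 volume)
    (hχ : Continuous χ) (hχc : HasCompactSupport χ) :
    Integrable (fun q : (Euc d × ℝ) × Euc d =>
      ψ q.1.1 * κ q.1.2 * (w (q.2 + (q.1.2 * ρ) • q.1.1) * χ q.2))
      ((volume.prod (volume.restrict (Ioc (0 : ℝ) 1))).prod volume) := by
  have hχ2 : MemLp χ 2 volume := hχ.memLp_of_hasCompactSupport hχc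
  have hmeas : Measurable (fun q : (Euc d × ℝ) × Euc d =>
      ψ q.1.1 * κ q.1.2 * (w (q.2 + (q.1.2 * ρ) • q.1.1) * χ q.2)) := by
    have h1 : Measurable fun q : (Euc d × ℝ) × Euc d => w (q.2 + (q.1.2 * ρ) • q.1.1) :=
      hm.comp (by fun_prop)
    have h2 : Continuous fun q : (Euc d × ℝ) × Euc d => ψ q.1.1 * κ q.1.2 := by fun_prop
    exact h2.measurable.mul (h1.mul (hχ.measurable.comp measurable_snd))
  rw [integrable_prod_iff hmeas.aestronglyMeasurable]
  refine ⟨Filter.Eventually.of_forall fun p =>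
    (integrable_mul_of_memLp (memLp_comp_add hw ((p.2 * ρ) • p.1)) hχ2).const_mul
      (ψ p.1 * κ p.2), ?_⟩
  have hκi : Integrable κ (volume.restrict (Ioc (0 : ℝ) 1)) :=
    (hκ.integrableOn_Icc (a := 0) (b := 1)).mono_set Ioc_subset_Icc_self
  refine (((hψ.integrable_of_hasCompactSupport hc).mul_prod hκi).norm.mul_const
    (l2Norm univ w * l2Norm univ χ)).mono' ?_ ?_
  · exact (hmeas.norm.stronglyMeasurable.integral_prod_right').aestronglyMeasurable
  · refine Filter.Eventually.of_forall fun p => ?_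
    rw [Real.norm_of_nonneg (integral_nonneg fun _ => norm_nonneg _)]
    simp only [norm_mul (ψ p.1 * κ p.2), integral_const_mul]
    refine mul_le_mul_of_nonneg_left ?_ (norm_nonneg _)
    have := integral_abs_mul_le (memLp_comp_add hw ((p.2 * ρ) • p.1)) hχ2
    rwa [l2Norm_comp_add] at this

theorem integrable_radial_pairing {κ : ℝ → ℝ} (hκ : Continuous κ) {ψ w χ : Euc d → ℝ} (ρ : ℝ)
    (hψ : Continuous ψ) (hc : HasCompactSupport ψ) (hm : Measurable w) (hw : MemLp w 2 volume)
    (hχ : Continuous χ) (hχc : HasCompactSupport χ) :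
    Integrable (fun y => ∫ s in Ioc (0 : ℝ) 1,
      ψ y * κ s * ∫ t, w (t + (s * ρ) • y) * χ t) := by
  have h := (integrable_kernel_mul hκ ρ hψ hc hm hw hχ hχc).integral_prod_left.integral_prod_left
  simpa only [integral_const_mul] using h

theorem integral_radialPotential_mul {κ : ℝ → ℝ} (hκ : Continuous κ) {ψ w χ : Euc d → ℝ} (ρ : ℝ)
    (hψ : Continuous ψ) (hc : HasCompactSupport ψ) (hm : Measurable w) (hw : MemLp w 2 volume)
    (hχ : Continuous χ) (hχc : HasCompactSupport χ) :
    ∫ t, radialPotential κ ψ ρ w t * χ t =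
      ∫ y, ∫ s in Ioc (0 : ℝ) 1, ψ y * κ s * ∫ t, w (t + (s * ρ) • y) * χ t := by
  have hF := integrable_kernel_mul hκ ρ hψ hc hm hw hχ hχc
  have h1 := integral_prod _ hF.integral_prod_left
  have h2 := integral_integral_swap
    (f := fun (p : Euc d × ℝ) t => ψ p.1 * κ p.2 * (w (t + (p.2 * ρ) • p.1) * χ t)) hF
  simp only [integral_const_mul] at h1 h2
  rw [← h1, h2]
  refine integral_congr_ae ?_
  filter_upwards [hF.prod_left_ae] with t ht
  rw [integral_prod_symm _ ht, radialPotential, ← integral_mul_const]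
  refine integral_congr_ae (Filter.Eventually.of_forall fun s => ?_)
  simp only [scaledAverage]
  rw [← integral_const_mul, ← integral_mul_const]
  refine integral_congr_ae (Filter.Eventually.of_forall fun y => ?_)
  simp only
  ring

/-! ### The Taylor formula for weak derivatives, tested against smooth functions. -/

theorem hasDerivAt_integral_mul_comp_sub {u g : Euc d → ℝ} (hu : LocallyIntegrable u volume)
    (hg : ContDiff ℝ ∞ g) (hc : HasCompactSupport g) (e : Euc d) (s₀ : ℝ) :
    HasDerivAt (fun s : ℝ => ∫ z, u z * g (z - s • e))
      (-∫ z, u z * dirD e g (z - s₀ • e)) s₀ := by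
  have hcont : Continuous (dirD e g) := (contDiff_dirD e hg).continuous
  have hc' : HasCompactSupport (dirD e g) :=
    hc.of_isClosed_subset (isClosed_tsupport _) (tsupport_dirD_subset e g)
  obtain ⟨M, hM⟩ := hc'.exists_bound_of_continuous hcont
  obtain ⟨R, hR⟩ := hc.isBounded.subset_closedBall (0 : Euc d)
  -- One compact set containing the translates of the support for all |s - s₀| < 1; local
  -- integrability of u on it yields the dominating function.
  set K : Set (Euc d) := Metric.closedBall 0 (R + (|s₀| + 1) * ‖e‖) with hK
  have hKc : IsCompact K := isCompact_closedBall _ _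
  have hM0 : 0 ≤ M := (norm_nonneg _).trans (hM 0)
  have hzero : ∀ s ∈ Metric.ball s₀ 1, ∀ z ∉ K, dirD e g (z - s • e) = 0 := by
    intro s hs z hz
    by_contra hne
    have h1 : z - s • e ∈ tsupport g := tsupport_dirD_subset e g (subset_tsupport _ hne)
    have h2 : ‖z - s • e‖ ≤ R := by simpa using hR h1
    refine hz ?_
    rw [hK, mem_closedBall_zero_iff]
    have h3 : |s| ≤ |s₀| + 1 := by
      have h := abs_sub_abs_le_abs_sub s s₀
      rw [Metric.mem_ball, Real.dist_eq] at hs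
      linarith
    calc ‖z‖ = ‖(z - s • e) + s • e‖ := by rw [sub_add_cancel]
      _ ≤ ‖z - s • e‖ + |s| * ‖e‖ := by
        simpa [norm_smul] using norm_add_le (z - s • e) (s • e)
      _ ≤ _ := add_le_add h2 (mul_le_mul_of_nonneg_right h3 (norm_nonneg e))
  have hint : ∀ (s : ℝ) (f : Euc d → ℝ), Continuous f → HasCompactSupport f →
      Integrable (fun z => u z * f (z - s • e)) := by
    intro s f hf hfc
    have h := hu.integrable_smul_left_of_hasCompactSupport (g := fun z => f (z - s • e))
      (hf.comp (continuous_id.sub continuous_const))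
      (hfc.comp_homeomorph (Homeomorph.subRight (s • e)))
    simpa only [smul_eq_mul, mul_comm] using h
  have main := (hasDerivAt_integral_of_dominated_loc_of_deriv_le (μ := (volume : Measure (Euc d)))
    (F := fun (s : ℝ) z => u z * g (z - s • e))
    (F' := fun (s : ℝ) z => u z * -dirD e g (z - s • e)) (x₀ := s₀)
    (bound := K.indicator fun z => M * ‖u z‖)
    (Metric.ball_mem_nhds s₀ one_pos)
    (Filter.Eventually.of_forall fun s => (hint s g hg.continuous hc).aestronglyMeasurable)
    (hint s₀ g hg.continuous hc)
    (hint s₀ (fun x => -dirD e g x) hcont.neg hc'.neg).aestronglyMeasurable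
    (Filter.Eventually.of_forall fun z s hs => ?_) ?_
    (Filter.Eventually.of_forall fun z s _ => ?_)).2
  · simpa only [mul_neg, integral_neg] using main
  · by_cases hz : z ∈ K
    · rw [indicator_of_mem hz, norm_mul, norm_neg, mul_comm]
      exact mul_le_mul_of_nonneg_right (hM _) (norm_nonneg _)
    · rw [indicator_of_notMem hz, hzero s hs z hz]
      simp
  · rw [integrable_indicator_iff hKc.measurableSet]
    exact ((hu.integrableOn_isCompact hKc).norm).const_mul M
  · refine HasDerivAt.const_mul _ ?_
    have h1 : HasDerivAt (fun s : ℝ => z - s • e) (-e) s := by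
      simpa using ((hasDerivAt_id s).smul_const e).const_sub z
    have h2 := ((hg.differentiable (by simp) (z - s • e)).hasFDerivAt).comp_hasDerivAt s h1
    rw [map_neg] at h2
    exact h2

/-- `W k`, for `|k| = n + 1`, are globally defined measurable representatives of the weak
derivatives on `Ω` of `u`. -/
structure IsWeakJet (n : ℕ) (Ω : Set (Euc d)) (u : Euc d → ℝ) (W : (Fin d → ℕ) → Euc d → ℝ) :
    Prop where
  measurable : Measurable u
  memLp : MemLp u 2 volume
  measurable_weak : ∀ k, ∑ i, k i = n + 1 → Measurable (W k)
  memLp_weak : ∀ k, ∑ i, k i = n + 1 → MemLp (W k) 2 volume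
  integral_eq : ∀ k, ∑ i, k i = n + 1 → ∀ φ, IsTestFunction Ω φ →
    ∫ x, u x * classicalD k φ x = (-1) ^ (n + 1) * ∫ x, W k x * φ x

theorem integral_comp_add_mul (w χ : Euc d → ℝ) (a : Euc d) :
    ∫ t, w (t + a) * χ t = ∫ z, w z * χ (z - a) := by
  rw [← integral_add_right_eq_self (fun z => w z * χ (z - a)) a]
  simp

/-- This is the one-dimensional formula for s ↦ ∫ u(t + sρy) χ(t) dt. No smoothness of u is needed,
because after translation the dependence on s sits in χ. -/
theorem IsWeakJet.integral_mul_eq {n : ℕ} {Ω : Set (Euc d)} {u : Euc d → ℝ}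
    {W : (Fin d → ℕ) → Euc d → ℝ} (hW : IsWeakJet n Ω u W) {h : ℕ → ℝ → ℝ}
    (hh : IsTaylorKernel n h) {χ : Euc d → ℝ} (hχ : ContDiff ℝ ∞ χ) (hc : HasCompactSupport χ)
    {ρ : ℝ} (hρ : 0 < ρ) (hΩ : ∀ x ∈ tsupport χ, Metric.closedBall x ρ ⊆ Ω) {y : Euc d}
    (hy : ‖y‖ ≤ 1) :
    ∫ x, u x * χ x = (-1) ^ (n + 1) * (ρ ^ (n + 1) * ∑ I : Fin (n + 1) → Fin d, (∏ j, y (I j)) *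
        ∫ s in Ioc (0 : ℝ) 1, h 0 s * ∫ t, W (multiIndex I) (t + (s * ρ) • y) * χ t) -
      ∫ s in Ioc (0 : ℝ) 1, h (n + 1) s * ∫ t, u (t + (s * ρ) • y) * χ t := by
  set e : Euc d := ρ • y with he
  have hse : ∀ s : ℝ, (s * ρ) • y = s • e := fun s => by rw [he, smul_smul]
  have hloc : ∀ {w : Euc d → ℝ}, MemLp w 2 volume → LocallyIntegrable w volume :=
    fun hw => hw.locallyIntegrable one_le_two
  have hcs : ∀ j, HasCompactSupport ((dirD e)^[j] χ) := fun j =>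
    hc.of_isClosed_subset (isClosed_tsupport _) (tsupport_iterate_dirD_subset e χ j)
  -- The sign absorbs the -1 produced whenever d/ds falls on χ(z - se).
  set f : ℕ → ℝ → ℝ := fun j s => (-1) ^ j * ∫ z, u z * (dirD e)^[j] χ (z - s • e) with hf
  have hfd : ∀ j s, HasDerivAt (f j) (f (j + 1) s) s := by
    intro j s
    have h1 := (hasDerivAt_integral_mul_comp_sub (hloc hW.memLp) (contDiff_iterate_dirD e hχ j)
      (hcs j) e s).const_mul ((-1 : ℝ) ^ j)
    have h2 : f (j + 1) s = (-1) ^ j * -∫ z, u z * dirD e ((dirD e)^[j] χ) (z - s • e) := by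
      rw [hf]
      simp only [Function.iterate_succ', Function.comp_apply, pow_succ]
      ring
    rw [h2]
    exact h1
  have hcontW : ∀ I : Fin (n + 1) → Fin d,
      Continuous fun s : ℝ => ∫ z, W (multiIndex I) z * χ (z - s • e) := fun I =>
    continuous_iff_continuousAt.2 fun s => (hasDerivAt_integral_mul_comp_sub
      (hloc (hW.memLp_weak _ (sum_multiIndex I))) hχ hc e s).continuousAt
  -- For s ≤ 1 the translate of χ moves by at most ρ, so it is still a test function on Ω and the
  -- weak derivatives apply.
  have htop : ∀ s ∈ Ioc (0 : ℝ) 1, f (n + 1) s = ρ ^ (n + 1) *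
      ∑ I : Fin (n + 1) → Fin d, (∏ j, y (I j)) * ∫ z, W (multiIndex I) z * χ (z - s • e) := by
    intro s hs
    have htest : IsTestFunction Ω (fun x => χ (x - s • e)) := by
      refine IsTestFunction.comp_sub hχ hc fun x hx => hΩ x hx ?_
      rw [Metric.mem_closedBall, dist_eq_norm, add_sub_cancel_left, he, norm_smul, norm_smul,
        Real.norm_of_nonneg hs.1.le, Real.norm_of_nonneg hρ.le]
      have : ρ * ‖y‖ ≤ ρ := mul_le_of_le_one_right hρ.le hy
      exact (mul_le_of_le_one_left (by positivity) hs.2).trans this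
    have hI : ∀ I : Fin (n + 1) → Fin d,
        ∫ z, u z * classicalD (multiIndex I) χ (z - s • e) =
          (-1) ^ (n + 1) * ∫ z, W (multiIndex I) z * χ (z - s • e) := by
      intro I
      rw [← hW.integral_eq _ (sum_multiIndex I) _ htest, classicalD_eq_listD,
        classicalD_eq_listD, listD_comp_sub]
    have hint : ∀ I : Fin (n + 1) → Fin d,
        Integrable fun z => u z * classicalD (multiIndex I) χ (z - s • e) := by
      intro I
      have hcI : HasCompactSupport (classicalD (multiIndex I) χ) :=
        hc.of_isClosed_subset (isClosed_tsupport _) (tsupport_listD_subset _ _ _)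
      have hsI : Continuous (classicalD (multiIndex I) χ) := (contDiff_listD _ _ hχ).continuous
      exact integrable_mul_of_memLp hW.memLp
        ((hsI.comp (continuous_id.sub continuous_const)).memLp_of_hasCompactSupport
          (hcI.comp_homeomorph (Homeomorph.subRight (s • e))))
    have hexp : ∀ z, u z * (dirD e)^[n + 1] χ (z - s • e) =
        ∑ I : Fin (n + 1) → Fin d, (∏ j, e (I j)) *
          (u z * classicalD (multiIndex I) χ (z - s • e)) := by
      intro z
      rw [iterate_dirD_eq_sum e hχ, Finset.mul_sum]
      exact Finset.sum_congr rfl fun I _ => by ring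
    simp only [hf, hexp]
    rw [integral_finsetSum _ fun I _ => (hint I).const_mul _, Finset.mul_sum, Finset.mul_sum]
    refine Finset.sum_congr rfl fun I _ => ?_
    have hprod : ∏ j, e (I j) = ρ ^ (n + 1) * ∏ j, y (I j) := by
      simp [he, Finset.prod_mul_distrib]
    have hsq : ((-1 : ℝ) ^ (n + 1)) * (-1) ^ (n + 1) = 1 := by rw [← mul_pow]; norm_num
    rw [integral_const_mul, hI, hprod]
    linear_combination (ρ ^ (n + 1) * (∏ j, y (I j)) *
      ∫ z, W (multiIndex I) z * χ (z - s • e)) * hsq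
  have key := eval_zero_eq_integral_iterated_deriv h f hh.hasDerivAt hfd hh.zero_of_lt hh.one
    hh.end_zero
  rw [intervalIntegral.integral_of_le zero_le_one, intervalIntegral.integral_of_le zero_le_one,
    setIntegral_congr_fun (g := fun s => ∑ I : Fin (n + 1) → Fin d,
      ρ ^ (n + 1) * ((∏ j, y (I j)) * (h 0 s * ∫ z, W (multiIndex I) z * χ (z - s • e))))
      measurableSet_Ioc (fun s hs => ?_)] at key
  · rw [integral_finsetSum _ fun I _ => ?_] at key
    · simp only [integral_const_mul, ← Finset.mul_sum] at key
      simpa only [hf, hse, integral_comp_add_mul, pow_zero, one_mul, Function.iterate_zero, id,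
        zero_smul, sub_zero] using key
    · exact (((((hh.continuous 0).mul (hcontW I)).integrableOn_Icc (a := 0) (b := 1)).mono_set
        Ioc_subset_Icc_self).const_mul _).const_mul _
  · simp only
    rw [htop s hs, Finset.mul_sum, Finset.mul_sum]
    exact Finset.sum_congr rfl fun I _ => by ring

/-! ### The integral representation: continuity, agreement with u, and bound. -/

/-- The integral representation of `u` by averages, over balls of radius at most `ρ`, of `u` and
its weak derivatives of order `n + 1`. -/
noncomputable def sobolevRep (n : ℕ) (h : ℕ → ℝ → ℝ) (φ : Euc d → ℝ) (u : Euc d → ℝ)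
    (W : (Fin d → ℕ) → Euc d → ℝ) (ρ : ℝ) (t : Euc d) : ℝ :=
  (-1) ^ (n + 1) * (ρ ^ (n + 1) * ∑ I : Fin (n + 1) → Fin d,
    radialPotential (h 0) (fun y => φ y * ∏ j, y (I j)) ρ (W (multiIndex I)) t) -
  radialPotential (h (n + 1)) φ ρ u t

/-- A continuous weight of total mass one supported in the closed unit ball. -/
structure IsUnitWeight (φ : Euc d → ℝ) : Prop where
  continuous : Continuous φ
  compact : HasCompactSupport φ
  norm_le : ∀ y, φ y ≠ 0 → ‖y‖ ≤ 1
  integral : ∫ y, φ y = 1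

theorem exists_isUnitWeight (d : ℕ) : ∃ φ : Euc d → ℝ, IsUnitWeight φ := by
  let b : ContDiffBump (0 : Euc d) := ⟨1 / 2, 1, by norm_num, by norm_num⟩
  refine ⟨b.normed volume, b.continuous_normed, b.hasCompactSupport_normed, fun y hy => ?_,
    b.integral_normed⟩
  have : y ∈ Function.support (b.normed volume) := hy
  rw [b.support_normed_eq] at this
  exact (by simpa using this : ‖y‖ < 1).le

theorem IsUnitWeight.continuous_mul {φ : Euc d → ℝ} (hφ : IsUnitWeight φ) {m : ℕ}
    (I : Fin m → Fin d) : Continuous fun y : Euc d => φ y * ∏ j, y (I j) :=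
  hφ.continuous.mul (by fun_prop)

theorem IsUnitWeight.compact_mul {φ : Euc d → ℝ} (hφ : IsUnitWeight φ) {m : ℕ}
    (I : Fin m → Fin d) : HasCompactSupport fun y : Euc d => φ y * ∏ j, y (I j) :=
  hφ.compact.mul_right

theorem continuous_sobolevRep {n : ℕ} (hn : (d : ℝ) / 2 < (n + 1 : ℕ)) {Ω : Set (Euc d)}
    {u : Euc d → ℝ} {W : (Fin d → ℕ) → Euc d → ℝ} (hW : IsWeakJet n Ω u W) {h : ℕ → ℝ → ℝ}
    (hh : IsTaylorKernel n h) {φ : Euc d → ℝ} (hφ : IsUnitWeight φ) {ρ : ℝ} (hρ : 0 < ρ) :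
    Continuous (sobolevRep n h φ u W ρ) := by
  obtain ⟨C, -, hC⟩ := hh.bound
  refine (continuous_const.mul (continuous_const.mul (continuous_finsetSum _ fun I _ => ?_))).sub ?_
  · exact continuous_radialPotential (hh.continuous _) hn (fun s hs => (hC s hs).1) hρ
      (hφ.continuous_mul I) (hφ.compact_mul I) (hW.measurable_weak _ (sum_multiIndex I))
      (hW.memLp_weak _ (sum_multiIndex I))
  · exact continuous_radialPotential (hh.continuous _) hn (fun s hs => (hC s hs).2) hρ
      hφ.continuous hφ.compact hW.measurable hW.memLp

/-- Fubini moves the y-integral outside; for each y in the support of φ the integrand is φ(y) times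
the tested Taylor formula, and φ has mass one. -/
theorem integral_sobolevRep_mul {n : ℕ} (hn : (d : ℝ) / 2 < (n + 1 : ℕ)) {Ω : Set (Euc d)}
    {u : Euc d → ℝ} {W : (Fin d → ℕ) → Euc d → ℝ} (hW : IsWeakJet n Ω u W) {h : ℕ → ℝ → ℝ}
    (hh : IsTaylorKernel n h) {φ : Euc d → ℝ} (hφ : IsUnitWeight φ) {ρ : ℝ} (hρ : 0 < ρ)
    {χ : Euc d → ℝ} (hχ : ContDiff ℝ ∞ χ) (hc : HasCompactSupport χ)
    (hΩ : ∀ x ∈ tsupport χ, Metric.closedBall x ρ ⊆ Ω) :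
    ∫ t, sobolevRep n h φ u W ρ t * χ t = ∫ t, u t * χ t := by
  obtain ⟨C, -, hC⟩ := hh.bound
  have hmulint : ∀ g : Euc d → ℝ, Continuous g → Integrable fun t => g t * χ t := fun g hg =>
    (hg.mul hχ.continuous).integrable_of_hasCompactSupport hc.mul_left
  set P : (Fin (n + 1) → Fin d) → Euc d → ℝ := fun I =>
    radialPotential (h 0) (fun y => φ y * ∏ j, y (I j)) ρ (W (multiIndex I)) with hP
  have hPc : ∀ I, Continuous (P I) := fun I =>
    continuous_radialPotential (hh.continuous _) hn (fun s hs => (hC s hs).1) hρ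
      (hφ.continuous_mul I) (hφ.compact_mul I) (hW.measurable_weak _ (sum_multiIndex I))
      (hW.memLp_weak _ (sum_multiIndex I))
  have hQc : Continuous (radialPotential (h (n + 1)) φ ρ u) :=
    continuous_radialPotential (hh.continuous _) hn (fun s hs => (hC s hs).2) hρ
      hφ.continuous hφ.compact hW.measurable hW.memLp
  have e1 : ∀ t, sobolevRep n h φ u W ρ t * χ t =
      (-1) ^ (n + 1) * (ρ ^ (n + 1) * ∑ I, P I t * χ t) -
        radialPotential (h (n + 1)) φ ρ u t * χ t := by
    intro t
    rw [← Finset.sum_mul, sobolevRep]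
    ring
  simp only [e1]
  rw [integral_sub (((integrable_finsetSum _ fun I _ => hmulint _ (hPc I)).const_mul _).const_mul _)
    (hmulint _ hQc), integral_const_mul, integral_const_mul,
    integral_finsetSum _ fun I _ => hmulint _ (hPc I)]
  have hIint := fun I : Fin (n + 1) → Fin d =>
    integrable_radial_pairing (hh.continuous 0) ρ (hφ.continuous_mul I) (hφ.compact_mul I)
      (hW.measurable_weak _ (sum_multiIndex I)) (hW.memLp_weak _ (sum_multiIndex I))
      hχ.continuous hc
  have hUint := integrable_radial_pairing (hh.continuous (n + 1)) ρ hφ.continuous hφ.compact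
    hW.measurable hW.memLp hχ.continuous hc
  simp only [hP]
  simp only [fun I : Fin (n + 1) → Fin d =>
    integral_radialPotential_mul (hh.continuous 0) ρ (hφ.continuous_mul I) (hφ.compact_mul I)
      (hW.measurable_weak _ (sum_multiIndex I)) (hW.memLp_weak _ (sum_multiIndex I))
      hχ.continuous hc,
    integral_radialPotential_mul (hh.continuous (n + 1)) ρ hφ.continuous hφ.compact
      hW.measurable hW.memLp hχ.continuous hc]
  rw [← integral_finsetSum _ fun I _ => hIint I, ← integral_const_mul, ← integral_const_mul,
    ← integral_sub (((integrable_finsetSum _ fun I _ => hIint I).const_mul _).const_mul _) hUint]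
  have e2 : ∫ t, u t * χ t = ∫ y, φ y * ∫ t, u t * χ t := by
    rw [integral_mul_const, hφ.integral, one_mul]
  rw [e2]
  refine integral_congr_ae (Filter.Eventually.of_forall fun y => ?_)
  simp only [mul_assoc, integral_const_mul, ← Finset.mul_sum]
  by_cases hy : φ y = 0
  · simp [hy]
  · rw [hW.integral_mul_eq hh hχ hc hρ hΩ (hφ.norm_le y hy)]
    ring

/-- Both functions are weak derivatives of u of order 0 on the ball, hence agree by uniqueness. The
double ball leaves room ρ around every point of the support of a test function. -/
theorem sobolevRep_ae_eq {n : ℕ} (hn : (d : ℝ) / 2 < (n + 1 : ℕ)) {Ω : Set (Euc d)}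
    {u : Euc d → ℝ} {W : (Fin d → ℕ) → Euc d → ℝ} (hW : IsWeakJet n Ω u W) {h : ℕ → ℝ → ℝ}
    (hh : IsTaylorKernel n h) {φ : Euc d → ℝ} (hφ : IsUnitWeight φ) {ρ : ℝ} (hρ : 0 < ρ)
    {t : Euc d} (ht : Metric.ball t (2 * ρ) ⊆ Ω) :
    sobolevRep n h φ u W ρ =ᵐ[volume.restrict (Metric.ball t ρ)] u := by
  have hset : ∀ (w χ : Euc d → ℝ), IsTestFunction (Metric.ball t ρ) χ →
      ∫ x in Metric.ball t ρ, w x * χ x = ∫ x, w x * χ x := by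
    intro w χ hχ
    refine setIntegral_eq_integral_of_forall_compl_eq_zero fun x hx => ?_
    rw [image_eq_zero_of_notMem_tsupport fun h => hx (hχ.support h), mul_zero]
  have hD : ∀ χ : Euc d → ℝ, classicalD 0 χ = χ := fun χ => listD_zero _ χ
  refine HasWeakD.ae_eq (k := 0) (u := u) Metric.isOpen_ball
    ⟨((continuous_sobolevRep hn hW hh hφ hρ).locallyIntegrable).locallyIntegrableOn _,
      fun χ hχ => ?_⟩
    ⟨(hW.memLp.locallyIntegrable one_le_two).locallyIntegrableOn _, fun χ _ => ?_⟩
  · rw [hD, hset _ _ hχ, hset _ _ hχ,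
      integral_sobolevRep_mul hn hW hh hφ hρ hχ.smooth hχ.compact fun x hx => ?_]
    · simp
    · refine Subset.trans (fun z hz => ?_) ht
      have h1 := hχ.support hx
      rw [Metric.mem_ball] at h1 ⊢
      rw [Metric.mem_closedBall] at hz
      linarith [dist_triangle z x t]
  · rw [hD]; simp

theorem exists_abs_sobolevRep_le {n : ℕ} (hn : (d : ℝ) / 2 < (n + 1 : ℕ)) {h : ℕ → ℝ → ℝ}
    (hh : IsTaylorKernel n h) {φ : Euc d → ℝ} (hφ : IsUnitWeight φ) :
    ∃ K, 0 ≤ K ∧ ∀ (Ω : Set (Euc d)) (u : Euc d → ℝ) (W : (Fin d → ℕ) → Euc d → ℝ) (S : ℝ),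
      0 ≤ S → IsWeakJet n Ω u W → (∀ k, ∑ i, k i = n + 1 → l2Norm univ (W k) ≤ S) →
      ∀ ρ, 0 < ρ → ∀ t, |sobolevRep n h φ u W ρ t| ≤
        K * ρ ^ (-(d : ℝ) / 2) * (l2Norm univ u + ρ ^ (n + 1) * S) := by
  obtain ⟨C, hC0, hC⟩ := hh.bound
  have hm := radialMass_nonneg d n
  set A : ℝ := ∑ I : Fin (n + 1) → Fin d, l2Norm univ (fun y : Euc d => φ y * ∏ j, y (I j)) with hA
  have hA0 : 0 ≤ A := Finset.sum_nonneg fun I _ => l2Norm_nonneg _ _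
  have hB0 : 0 ≤ l2Norm univ φ := l2Norm_nonneg _ _
  refine ⟨C * (A + l2Norm univ φ) * radialMass d n, by positivity, ?_⟩
  intro Ω u W S hS0 hW hS ρ hρ t
  have hu0 : 0 ≤ l2Norm univ u := l2Norm_nonneg _ _
  have hr : 0 ≤ ρ ^ (-(d : ℝ) / 2) := Real.rpow_nonneg hρ.le _
  have b1 : ∀ I : Fin (n + 1) → Fin d,
      |radialPotential (h 0) (fun y => φ y * ∏ j, y (I j)) ρ (W (multiIndex I)) t| ≤
      l2Norm univ (fun y : Euc d => φ y * ∏ j, y (I j)) *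
        (C * radialMass d n * ρ ^ (-(d : ℝ) / 2) * S) := by
    intro I
    have hk := sum_multiIndex I
    refine (abs_radialPotential_le hn (fun s hs => (hC s hs).1) hρ
      ((hφ.continuous_mul I).memLp_of_hasCompactSupport (hφ.compact_mul I))
      (hW.measurable_weak _ hk) (hW.memLp_weak _ hk) t).trans ?_
    have h0 := l2Norm_nonneg univ (fun y : Euc d => φ y * ∏ j, y (I j))
    calc _ = l2Norm univ (fun y : Euc d => φ y * ∏ j, y (I j)) *
          (C * radialMass d n * ρ ^ (-(d : ℝ) / 2) * l2Norm univ (W (multiIndex I))) := by ring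
      _ ≤ _ := by gcongr; exact hS _ hk
  have b2 : |radialPotential (h (n + 1)) φ ρ u t| ≤
      C * l2Norm univ φ * (ρ ^ (-(d : ℝ) / 2) * l2Norm univ u) * radialMass d n :=
    abs_radialPotential_le hn (fun s hs => (hC s hs).2) hρ
      (hφ.continuous.memLp_of_hasCompactSupport hφ.compact) hW.measurable hW.memLp t
  have b3 : |∑ I : Fin (n + 1) → Fin d,
      radialPotential (h 0) (fun y => φ y * ∏ j, y (I j)) ρ (W (multiIndex I)) t| ≤
      A * (C * radialMass d n * ρ ^ (-(d : ℝ) / 2) * S) := by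
    refine (Finset.abs_sum_le_sum_abs _ _).trans ?_
    rw [hA, Finset.sum_mul]
    exact Finset.sum_le_sum fun I _ => b1 I
  rw [sobolevRep]
  refine (abs_sub _ _).trans ?_
  rw [abs_mul, abs_mul, abs_pow, abs_neg, abs_one, one_pow, one_mul,
    abs_of_pos (pow_pos hρ _)]
  refine (add_le_add (mul_le_mul_of_nonneg_left b3 (pow_pos hρ (n + 1)).le) b2).trans ?_
  have hp := (pow_pos hρ (n + 1)).le
  have x1 : 0 ≤ C * A * radialMass d n * ρ ^ (-(d : ℝ) / 2) * l2Norm univ u := by positivity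
  have x2 : 0 ≤ C * l2Norm univ φ * radialMass d n * ρ ^ (-(d : ℝ) / 2) *
    (ρ ^ (n + 1) * S) := by positivity
  linarith [x1, x2]

/-! ### Extension by zero to the whole space. -/

theorem exists_measurable_memLp {Ω : Set (Euc d)} (hΩ : MeasurableSet Ω) {f : Euc d → ℝ}
    (hf : MemLp f 2 (volume.restrict Ω)) :
    ∃ g : Euc d → ℝ, Measurable g ∧ MemLp g 2 volume ∧ g =ᵐ[volume] Ω.indicator f := by
  have h := (memLp_indicator_iff_restrict hΩ).2 hf
  exact ⟨h.1.mk _, h.1.stronglyMeasurable_mk.measurable, h.ae_eq h.1.ae_eq_mk,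
    h.1.ae_eq_mk.symm⟩

theorem integral_mul_eq_setIntegral {Ω : Set (Euc d)} (hΩ : MeasurableSet Ω) {f g : Euc d → ℝ}
    (hg : g =ᵐ[volume] Ω.indicator f) (φ : Euc d → ℝ) :
    ∫ x, g x * φ x = ∫ x in Ω, f x * φ x := by
  rw [← integral_indicator hΩ]
  refine integral_congr_ae ?_
  filter_upwards [hg] with x hx
  rw [hx]
  by_cases h : x ∈ Ω <;> simp [h]

theorem l2Norm_univ_eq {Ω : Set (Euc d)} (hΩ : MeasurableSet Ω) {f g : Euc d → ℝ}
    (hg : g =ᵐ[volume] Ω.indicator f) : l2Norm univ g = l2Norm Ω f := by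
  rw [l2Norm_univ, l2Norm, ← integral_indicator hΩ]
  congr 1
  refine integral_congr_ae ?_
  filter_upwards [hg] with x hx
  rw [hx]
  by_cases h : x ∈ Ω <;> simp [h]

theorem l2Norm_weakD_le {α : ℕ} (Ω : Set (Euc d)) (u : Euc d → ℝ) {k : Fin d → ℕ}
    (hk : ∑ i, k i = α) : l2Norm Ω (weakD Ω k u) ≤ sobolevSeminorm α Ω u := by
  refine Real.sqrt_le_sqrt ?_
  exact Finset.single_le_sum (f := fun k => ∫ x in Ω, |weakD Ω k u x| ^ 2)
    (fun k _ => integral_nonneg fun x => by positivity)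
    (Finset.mem_piAntidiag.2 ⟨hk, fun i _ => Finset.mem_univ i⟩)

/-- Each function is extended by zero, then replaced by a Borel representative, so that compositions
such as w(t + sρy) are jointly measurable. Jumps across the boundary are harmless since test
functions live in Ω. -/
theorem MemSobolev.exists_isWeakJet {n : ℕ} {Ω : Set (Euc d)} (hΩ : IsOpen Ω) {u : Euc d → ℝ}
    (hu : MemSobolev (n + 1) Ω u) : ∃ (u' : Euc d → ℝ) (W : (Fin d → ℕ) → Euc d → ℝ),
      IsWeakJet n Ω u' W ∧ u' =ᵐ[volume.restrict Ω] u ∧ l2Norm univ u' = l2Norm Ω u ∧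
      ∀ k, ∑ i, k i = n + 1 → l2Norm univ (W k) ≤ sobolevSeminorm (n + 1) Ω u := by
  have hm := hΩ.measurableSet
  obtain ⟨u', hu'm, hu'L, hu'⟩ := exists_measurable_memLp hm hu.memLp
  have hex : ∀ k : Fin d → ℕ, ∃ g : Euc d → ℝ, ∑ i, k i = n + 1 →
      Measurable g ∧ MemLp g 2 volume ∧ g =ᵐ[volume] Ω.indicator (weakD Ω k u) := by
    intro k
    by_cases hk : ∑ i, k i = n + 1
    · obtain ⟨g, hg⟩ := exists_measurable_memLp hm (hu.weak k hk.le).2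
      exact ⟨g, fun _ => hg⟩
    · exact ⟨0, fun h => absurd h hk⟩
  choose W hW using hex
  refine ⟨u', W, ⟨hu'm, hu'L, fun k hk => (hW k hk).1, fun k hk => (hW k hk).2.1, ?_⟩, ?_,
    l2Norm_univ_eq hm hu', fun k hk => ?_⟩
  · intro k hk φ hφ
    have hweak : HasWeakD Ω k u (weakD Ω k u) := by
      have h := (hu.weak k hk.le).1
      rw [weakD, dif_pos h]
      exact h.choose_spec
    rw [integral_mul_eq_setIntegral hm hu', integral_mul_eq_setIntegral hm (hW k hk).2.2,
      hweak.integral_eq φ hφ, hk]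
  · rw [Filter.EventuallyEq, ae_restrict_iff' hm]
    filter_upwards [hu'] with x hx hxΩ
    rw [hx, indicator_of_mem hxΩ]
  · rw [l2Norm_univ_eq hm (hW k hk).2.2]
    exact l2Norm_weakD_le Ω u hk

/-! ### Gluing, the geometry of the dilate, and the final estimate. -/

/-- Continuous functions `F ρ`, each agreeing almost everywhere with `u` on the balls of radius `ρ`
whose double lies in `Ω`, glue to a continuous representative of `u` on `Ω`. -/
theorem exists_continuousOn_glue {Ω : Set (Euc d)} (hΩ : IsOpen Ω) {u : Euc d → ℝ}
    {F : ℝ → Euc d → ℝ} (hF : ∀ ρ, 0 < ρ → Continuous (F ρ))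
    (hFu : ∀ ρ, 0 < ρ → ∀ t, Metric.ball t (2 * ρ) ⊆ Ω →
      F ρ =ᵐ[volume.restrict (Metric.ball t ρ)] u) :
    ∃ v : Euc d → ℝ, v =ᵐ[volume.restrict Ω] u ∧ ContinuousOn v Ω ∧
      ∀ ρ, 0 < ρ → ∀ t, Metric.ball t (2 * ρ) ⊆ Ω → v t = F ρ t := by
  have hex : ∀ t, ∃ ρ : ℝ, t ∈ Ω → 0 < ρ ∧ Metric.ball t (2 * ρ) ⊆ Ω := by
    intro t
    by_cases ht : t ∈ Ω
    · obtain ⟨δ, hδ, hb⟩ := Metric.isOpen_iff.1 hΩ t ht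
      exact ⟨δ / 2, fun _ => ⟨half_pos hδ, by rwa [mul_div_cancel₀ _ two_ne_zero]⟩⟩
    · exact ⟨0, fun h => absurd h ht⟩
  choose R hR using hex
  -- Continuous functions equal almost everywhere on an open set are equal there, so the
  -- uncontrolled radius `R t` may be replaced near t₀ by a fixed one.
  have hloc : ∀ ρ, 0 < ρ → ∀ t₀, Metric.ball t₀ (2 * ρ) ⊆ Ω →
      ∀ t ∈ Metric.ball t₀ ρ, F (R t) t = F ρ t := by
    intro ρ hρ t₀ hb t ht
    have htΩ : t ∈ Ω := hb (Metric.ball_subset_ball (by linarith) ht)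
    obtain ⟨hRt, hRb⟩ := hR t htΩ
    have e1 := ae_restrict_of_ae_restrict_of_subset
      (inter_subset_left (t := Metric.ball t₀ ρ)) (hFu _ hRt t hRb)
    have e2 := ae_restrict_of_ae_restrict_of_subset
      (inter_subset_right (s := Metric.ball t (R t))) (hFu ρ hρ t₀ hb)
    have e : F (R t) =ᵐ[volume.restrict (Metric.ball t (R t) ∩ Metric.ball t₀ ρ)] F ρ := by
      filter_upwards [e1, e2] with x h1 h2 using h1.trans h2.symm
    exact Measure.eqOn_open_of_ae_eq e (Metric.isOpen_ball.inter Metric.isOpen_ball)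
      (hF _ hRt).continuousOn (hF ρ hρ).continuousOn ⟨Metric.mem_ball_self hRt, ht⟩
  refine ⟨fun t => F (R t) t, ?_, ?_, fun ρ hρ t hb => hloc ρ hρ t hb t (Metric.mem_ball_self hρ)⟩
  · rw [Filter.EventuallyEq, ae_restrict_iff' hΩ.measurableSet, ae_iff]
    refine measure_null_of_locally_null _ fun t₀ ht₀ => ?_
    have ht₀Ω : t₀ ∈ Ω := by
      by_contra h
      exact ht₀ fun h' => absurd h' h
    obtain ⟨hρ, hb⟩ := hR t₀ ht₀Ω
    refine ⟨_ ∩ Metric.ball t₀ (R t₀), Filter.inter_mem self_mem_nhdsWithin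
      (mem_nhdsWithin_of_mem_nhds (Metric.ball_mem_nhds t₀ hρ)), ?_⟩
    have h := hFu _ hρ t₀ hb
    rw [Filter.EventuallyEq, ae_restrict_iff' Metric.isOpen_ball.measurableSet, ae_iff] at h
    refine measure_mono_null (fun x hx => ?_) h
    intro hx'
    refine hx.1 fun _ => ?_
    rw [hloc _ hρ t₀ hb x hx.2]
    exact hx' hx.2
  · intro t₀ ht₀
    obtain ⟨hρ, hb⟩ := hR t₀ ht₀
    refine ((hF _ hρ).continuousAt.congr ?_).continuousWithinAt
    filter_upwards [Metric.ball_mem_nhds t₀ hρ] with t ht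
    exact (hloc _ hρ t₀ hb t ht).symm

theorem ball_subset_of_mem_dilate {x₀ : Euc d} {r : ℝ} {Ω : Set (Euc d)}
    (hstar : ∀ z ∈ Metric.ball x₀ r, StarConvex ℝ z Ω) {δ : ℝ} (hδ : 0 < δ) (hδ1 : δ ≤ 1)
    {t : Euc d} (ht : t ∈ dilate x₀ (1 - δ) Ω) : Metric.ball t (δ * r) ⊆ Ω := by
  obtain ⟨y, hy, rfl⟩ := ht
  intro x hx
  -- Solves x = δz + (1 - δ)y; the factor δ⁻¹ turns the radius δr into r, so z is a star centre.
  set z : Euc d := x₀ + δ⁻¹ • (x - (x₀ + (1 - δ) • (y - x₀))) with hz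
  have hzb : z ∈ Metric.ball x₀ r := by
    rw [Metric.mem_ball, dist_eq_norm] at hx ⊢
    rw [hz, add_sub_cancel_left, norm_smul, Real.norm_of_nonneg (inv_nonneg.2 hδ.le),
      inv_mul_lt_iff₀ hδ]
    exact hx
  have h := hstar z hzb hy hδ.le (sub_nonneg.2 hδ1) (by ring)
  have : δ • z + (1 - δ) • y = x := by
    rw [hz, smul_add, smul_smul, mul_inv_cancel₀ hδ.ne', one_smul]
    module
  rwa [this] at h

theorem scale_rpow_eq {ε r : ℝ} (hε : 0 < ε) (hr : 0 < r) (d : ℕ) :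
    (ε ^ 2 * r / 2) ^ (-(d : ℝ) / 2) = (r / 2) ^ (-(d : ℝ) / 2) * ε ^ (-(d : ℤ)) := by
  rw [mul_div_assoc, Real.mul_rpow (by positivity) (by positivity), mul_comm]
  congr 1
  rw [← Real.rpow_natCast, ← Real.rpow_mul hε.le, ← Real.rpow_intCast]
  congr 1
  push_cast
  ring

theorem interpolation_bound_eq {ε r : ℝ} (hε : 0 < ε) (hr : 0 < r) (d α : ℕ) (K N S : ℝ) :
    K * (ε ^ 2 * r / 2) ^ (-(d : ℝ) / 2) * (N + (ε ^ 2 * r / 2) ^ α * S) =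
      K * (r / 2) ^ (-(d : ℝ) / 2) * (ε ^ (-(d : ℤ)) * N +
        (r / 2) ^ α * (ε ^ (2 * (α : ℤ) - (d : ℤ)) * S)) := by
  have h2 : ε ^ (2 * (α : ℤ) - (d : ℤ)) = ε ^ (-(d : ℤ)) * (ε ^ 2) ^ α := by
    rw [sub_eq_neg_add, zpow_add₀ hε.ne', ← pow_mul]
    congr 1
  rw [scale_rpow_eq hε hr, h2, mul_div_assoc, mul_pow]
  ring

end SupInterp

open SupInterp in
theorem mainTheorem4 (d α : ℕ) (hd : 0 < d) (hα : (d : ℝ) / 2 < (α : ℝ)) (r : ℝ) (hr : 0 < r) :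
    ∃ c₁ K₁ : ℝ, 0 < c₁ ∧ 0 < K₁ ∧
      ∀ (x₀ : SupInterp.Euc d) (Ω : Set (SupInterp.Euc d)), IsOpen Ω →
        (∀ z ∈ Metric.ball x₀ r, StarConvex ℝ z Ω) →
        ∀ u : SupInterp.Euc d → ℝ, SupInterp.MemSobolev α Ω u →
          ∃ v : SupInterp.Euc d → ℝ,
            v =ᵐ[MeasureTheory.volume.restrict Ω] u ∧ ContinuousOn v Ω ∧
            ∀ ε : ℝ, 0 < ε → ε < c₁ →
              ∀ t ∈ SupInterp.dilate x₀ (1 - ε ^ 2) Ω,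
                |v t| ≤ K₁ * (ε ^ (-(d : ℤ)) * SupInterp.l2Norm Ω u
                  + ε ^ (2 * (α : ℤ) - (d : ℤ)) * SupInterp.sobolevSeminorm α Ω u) := by
  obtain ⟨n, rfl⟩ : ∃ n, α = n + 1 := by
    refine Nat.exists_eq_succ_of_ne_zero ?_
    rintro rfl
    have : (0 : ℝ) < d := Nat.cast_pos.2 hd
    rw [Nat.cast_zero] at hα
    linarith
  obtain ⟨h, hh⟩ := exists_isTaylorKernel n
  obtain ⟨φ, hφ⟩ := exists_isUnitWeight d
  obtain ⟨K, hK, hbound⟩ := exists_abs_sobolevRep_le hα hh hφ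
  set B : ℝ := K * (r / 2) ^ (-(d : ℝ) / 2) with hB
  have hB0 : 0 ≤ B := by positivity
  -- Any ε < 1 works, as only ε² ≤ 1 is needed. The final + 1 secures strict positivity, since B is
  -- only known to be nonnegative.
  refine ⟨1, B * (1 + (r / 2) ^ (n + 1)) + 1, one_pos, by positivity, ?_⟩
  intro x₀ Ω hΩ hstar u hu
  obtain ⟨u', W, hW, hae, hnorm, hS⟩ := hu.exists_isWeakJet hΩ
  obtain ⟨v, hvu, hvc, hv⟩ := exists_continuousOn_glue hΩ (u := u')
    (F := fun ρ => sobolevRep n h φ u' W ρ)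
    (fun ρ hρ => continuous_sobolevRep hα hW hh hφ hρ)
    (fun ρ hρ t ht => sobolevRep_ae_eq hα hW hh hφ hρ ht)
  refine ⟨v, hvu.trans hae, hvc, fun ε hε hε1 t ht => ?_⟩
  -- The radius ρ is half of ε²r because the representation needs the ball of radius 2ρ inside Ω.
  have hρ : 0 < ε ^ 2 * r / 2 := by positivity
  have hball : Metric.ball t (2 * (ε ^ 2 * r / 2)) ⊆ Ω := by
    rw [mul_div_cancel₀ _ two_ne_zero]
    exact ball_subset_of_mem_dilate hstar (by positivity) (pow_le_one₀ hε.le hε1.le) ht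
  rw [hv _ hρ t hball]
  have hS0 : 0 ≤ sobolevSeminorm (n + 1) Ω u := Real.sqrt_nonneg _
  refine (hbound Ω u' W _ hS0 hW hS _ hρ t).trans ?_
  rw [hnorm, interpolation_bound_eq hε hr, ← hB]
  have hX : 0 ≤ ε ^ (-(d : ℤ)) * l2Norm Ω u := mul_nonneg (by positivity) (l2Norm_nonneg _ _)
  have hY : 0 ≤ ε ^ (2 * ((n + 1 : ℕ) : ℤ) - (d : ℤ)) * sobolevSeminorm (n + 1) Ω u := by
    positivity
  set X := ε ^ (-(d : ℤ)) * l2Norm Ω u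
  set Y := ε ^ (2 * ((n + 1 : ℕ) : ℤ) - (d : ℤ)) * sobolevSeminorm (n + 1) Ω u
  have hc : 0 ≤ (r / 2) ^ (n + 1) := by positivity
  have h1 : 0 ≤ B * ((r / 2) ^ (n + 1) * X) := by positivity
  have h2 : 0 ≤ B * Y := by positivity
  linarith
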